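/- Let $d\ge 0$ and $T>0$, and let $\mathcal X$ be the set of continuous piecewise linear paths $[0,T]\to\mathbb R^d$. For $X\in\mathcal X$ and $s\in[0,T]$ let $S(X|_{[0,s]})$ be the signature of the restricted path, i.e. the family of iterated integrals $$S(X|_{[0,s]})^{(\alpha_1,\dots,\alpha_j)}=\int_{0<s_1<\dots<s_j<s}dX^{(\alpha_1)}_{s_1}\cdots dX^{(\alpha_j)}_{s_j},\qquad j\ge 0,\ \alpha_1,\dots,\alpha_j\in\{1,\dots,d\}$$ (equal to $1$ for $j=0$), and for $X,Y\in\mathcal X$ and $s,t\in[0,T]$ let $$k(X|_{[0,s]},Y|_{[0,t]})=\sum_{j=0}^\infty\ \sum_{\alpha\in\{1,\dots,d\}^j}S(X|_{[0,s]})^{\alpha}\,S(Y|_{[0,t]})^{\alpha}$$ be the signature kernel, i.e. the inner product of the two signatures in the Hilbert space $H=\bigoplus_{j\ge0}(\mathbb R^d)^{\otimes j}$. The signatures of all such restricted paths are square-summable (they lie in $H$), so that these series converge absolutely. Theorem 4.1. For all $X,Y,\gamma\in\mathcal X$ the directional derivative $$k_\gamma(X,Y)=\frac{\partial}{\partial\varepsilon}k(X+\varepsilon\gamma,Y)\Big|_{\varepsilon=0}$$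 exists, and $$k_\gamma(X,Y)=\int_0^T\!\!\int_0^T U(s,t)\,\widetilde U(T-s,T-t)\,\big(\dot\gamma_s^{\top}\dot Y_t\big)\,ds\,dt,$$ where the integrand is integrable on $[0,T]^2$, $U(s,t)=k(X|_{[0,s]},Y|_{[0,t]})$, $\widetilde U(s,t)=k(\overleftarrow X|_{[0,s]},\overleftarrow Y|_{[0,t]})$, and $\overleftarrow X_t=X_{T-t}$, $\overleftarrow Y_t=Y_{T-t}$ are the paths reversed in time. -/

import Mathlib

open MeasureTheory

noncomputable section

/-- `X` is a continuous piecewise linear path on `[0, T]` with values in `ℝ^d`: there are knots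
`0 = t₀ < t₁ < ⋯ < tₙ = T` such that `X` is affine on each closed interval `[tᵢ, tᵢ₊₁]`
(continuity on `[0, T]` follows because consecutive closed intervals share a knot).
The values of `X` outside `[0, T]` are irrelevant. -/
def IsPiecewiseLinear {d : ℕ} (T : ℝ) (X : ℝ → EuclideanSpace ℝ (Fin d)) : Prop :=
  ∃ (n : ℕ) (t : Fin (n + 1) → ℝ), StrictMono t ∧ t 0 = 0 ∧ t (Fin.last n) = T ∧
    ∀ i : Fin n, ∃ v : EuclideanSpace ℝ (Fin d),
      ∀ s ∈ Set.Icc (t i.castSucc) (t i.succ),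
        X s = X (t i.castSucc) + (s - t i.castSucc) • v

/-- The coordinate `S(X|_{[0,t]})^(α₁,…,αⱼ)` of the signature of the restriction of `X` to
`[0, t]`: the iterated integral of `dX^(α₁)_{s₁} ⋯ dX^(αⱼ)_{sⱼ}` over `0 < s₁ < ⋯ < sⱼ < t`,
with the outermost integration variable `sⱼ`, and `dX_s = (deriv X s) ds` (a piecewise linear
path is differentiable except at its finitely many knots). The empty word has coordinate `1`. -/
def signature {d : ℕ} (X : ℝ → EuclideanSpace ℝ (Fin d)) :
    (t : ℝ) → (j : ℕ) → (Fin j → Fin d) → ℝ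
  | _, 0, _ => 1
  | t, j + 1, α => ∫ s in (0 : ℝ)..t, signature X s j (Fin.init α) * (deriv X s) (α (Fin.last j))
termination_by _ j _ => j

/-- The signature kernel `k(X|_{[0,s]}, Y|_{[0,t]})`, the inner product of the two signatures in
the Hilbert direct sum over `j` of the tensor powers `(ℝ^d)^{⊗ j}` (with coordinates indexed by
the words of length `j`). -/
def signatureKernel {d : ℕ} (X : ℝ → EuclideanSpace ℝ (Fin d)) (s : ℝ)
    (Y : ℝ → EuclideanSpace ℝ (Fin d)) (t : ℝ) : ℝ :=
  ∑' j : ℕ, ∑ α : Fin j → Fin d, signature X s j α * signature Y t j α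

/-- The path `X` on `[0, T]` reversed in time. -/
def reversedPath {d : ℕ} (T : ℝ) (X : ℝ → EuclideanSpace ℝ (Fin d)) :
    ℝ → EuclideanSpace ℝ (Fin d) :=
  fun t => X (T - t)

end

/-! Write `w p = ⟨Ẋ, Ẏ⟩` at `p = (s, t)`. Splitting off the last letter of each word shows that `U`
solves the Volterra form of the Goursat problem, `U p = 1 + ∫ w U` over `[0, p]`
(`signatureKernel_eq_one_add`). Time reversal turns this into a backward equation for `V p = Ũ((T,
T) - p)`: `V p = 1 + ∫ w V` over `[p, (T, T)]`.

Integration over `[0, p]` and over `[p, (T, T)]` are adjoint by Fubini. Pairing the forward equation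
of another path `X'`, with weight `w'` and kernel `U'`, against the backward equation of `X` gives
the exact identity `k(X', Y) - k(X, Y) = ∫ (w' - w) U' V` (`signatureKernel_sub`). For `X' = X + εγ`
the weight changes by `ε ⟨γ̇, Ẏ⟩`; dividing by `ε` and letting `U' → U` under dominated convergence
gives the formula.

Piecewise linearity enters only through almost everywhere bounded velocity. -/

/-- `X` is differentiable with velocity bounded by `M` at almost every time of `[0, T]`. -/
def HasBoundedVelocity {d : ℕ} (T M : ℝ) (X : ℝ → EuclideanSpace ℝ (Fin d)) : Prop :=
  ∀ᵐ s ∂volume.restrict (Set.Icc 0 T), DifferentiableAt ℝ X s ∧ ‖deriv X s‖ ≤ M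

/-! ### Bounded velocity and factorial decay of the signature -/

section Velocity

variable {d : ℕ} {T M N : ℝ} {X Y γ : ℝ → EuclideanSpace ℝ (Fin d)}

theorem IsPiecewiseLinear.exists_hasBoundedVelocity (hX : IsPiecewiseLinear T X) :
    ∃ M, 0 ≤ M ∧ HasBoundedVelocity T M X := by
  obtain ⟨n, t, ht, h0, hn, hv⟩ := hX
  choose v hv using hv
  refine ⟨∑ i, ‖v i‖, Finset.sum_nonneg fun _ _ => norm_nonneg _, ?_⟩
  have hfin : (Set.range t).Finite := Set.finite_range t
  rw [HasBoundedVelocity, ae_restrict_iff' measurableSet_Icc]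
  filter_upwards [hfin.countable.ae_notMem volume] with s hs hsT
  have hne : ∀ i, t i ≠ s := fun i hi => hs ⟨i, hi⟩
  -- The largest knot below `s` starts the piece containing `s`; as `s` is not a knot, `X` is affine
  -- near `s`.
  obtain ⟨i, hi, hmax⟩ := (Finset.univ.filter fun i => t i < s).exists_max_image id
    ⟨0, by simpa [h0] using lt_of_le_of_ne hsT.1 (h0 ▸ hne 0)⟩
  simp only [Finset.mem_filter, Finset.mem_univ, true_and, id] at hi hmax
  have hlast : i ≠ Fin.last n := by
    rintro rfl
    exact absurd hsT.2 (not_le.2 (hn ▸ hi))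
  obtain ⟨k, rfl⟩ := Fin.exists_castSucc_eq.2 hlast
  have hk : s < t k.succ := by
    refine lt_of_le_of_ne (not_lt.1 fun h => ?_) (hne _).symm
    exact absurd (hmax _ h) (not_le.2 (Fin.castSucc_lt_succ))
  have heq : X =ᶠ[nhds s] fun u => X (t k.castSucc) + (u - t k.castSucc) • v k := by
    filter_upwards [Icc_mem_nhds hi hk] with u hu using hv k u hu
  have hd : HasDerivAt (fun u => X (t k.castSucc) + (u - t k.castSucc) • v k) (v k) s := by
    simpa using (((hasDerivAt_id s).sub_const (t k.castSucc)).smul_const (v k)).const_add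
      (X (t k.castSucc))
  have hd' := hd.congr_of_eventuallyEq heq
  refine ⟨hd'.differentiableAt, ?_⟩
  rw [hd'.deriv]
  exact Finset.single_le_sum (f := fun i => ‖v i‖) (fun _ _ => norm_nonneg _) (Finset.mem_univ k)

theorem HasBoundedVelocity.mono {T' M' : ℝ} (hX : HasBoundedVelocity T M X) (hT : T' ≤ T)
    (hM : M ≤ M') : HasBoundedVelocity T' M' X := by
  filter_upwards [ae_restrict_of_ae_restrict_of_subset (Set.Icc_subset_Icc_right hT) hX]
    with s hs using ⟨hs.1, hs.2.trans hM⟩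

theorem HasBoundedVelocity.deriv_add_smul (hX : HasBoundedVelocity T M X)
    (hγ : HasBoundedVelocity T N γ) (ε : ℝ) :
    ∀ᵐ s ∂volume.restrict (Set.Icc 0 T),
      deriv (fun u => X u + ε • γ u) s = deriv X s + ε • deriv γ s := by
  filter_upwards [hX, hγ] with s hs hs'
  exact (hs.1.hasDerivAt.add (hs'.1.hasDerivAt.const_smul ε)).deriv

theorem HasBoundedVelocity.add_smul (hX : HasBoundedVelocity T M X)
    (hγ : HasBoundedVelocity T N γ) (ε : ℝ) :
    HasBoundedVelocity T (M + |ε| * N) fun u => X u + ε • γ u := by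
  filter_upwards [hX, hγ, hX.deriv_add_smul hγ ε] with s hs hs' hd
  refine ⟨hs.1.add (hs'.1.const_smul ε), ?_⟩
  rw [hd]
  refine (norm_add_le _ _).trans (add_le_add hs.2 ?_)
  rw [norm_smul, Real.norm_eq_abs]
  exact mul_le_mul_of_nonneg_left hs'.2 (abs_nonneg _)

theorem HasBoundedVelocity.reversedPath (hX : HasBoundedVelocity T M X) :
    HasBoundedVelocity T M (reversedPath T X) := by
  have hmp : MeasurePreserving (fun s : ℝ => T - s) (volume.restrict (Set.Icc 0 T))
      (volume.restrict (Set.Icc 0 T)) := by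
    simpa using (Measure.measurePreserving_sub_left (volume : Measure ℝ) T).restrict_preimage
      (measurableSet_Icc (a := (0 : ℝ)) (b := T))
  filter_upwards [hmp.quasiMeasurePreserving.ae hX] with s hs
  refine ⟨?_, ?_⟩
  · exact hs.1.comp s ((differentiableAt_const T).sub differentiableAt_id)
  · rw [show _root_.reversedPath T X = fun u => X (T - u) from rfl, deriv_comp_const_sub, norm_neg]
    exact hs.2

theorem HasBoundedVelocity.ae_abs_le (hX : HasBoundedVelocity T M X) {s : ℝ} (hs : s ≤ T)
    (c : Fin d) : ∀ᵐ u, u ∈ Set.Ioc 0 s → |deriv X u c| ≤ M := by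
  have h := (ae_restrict_iff' measurableSet_Icc).1 hX
  filter_upwards [h] with u hu hus
  exact (PiLp.norm_apply_le (deriv X u) c).trans (hu ⟨hus.1.le, hus.2.trans hs⟩).2

theorem measurable_deriv_coord (X : ℝ → EuclideanSpace ℝ (Fin d)) (c : Fin d) :
    Measurable fun u => deriv X u c :=
  ((EuclideanSpace.proj (𝕜 := ℝ) c).continuous.measurable).comp (measurable_deriv X)

theorem HasBoundedVelocity.integrableOn_deriv_coord (hX : HasBoundedVelocity T M X) (c : Fin d) :
    IntegrableOn (fun u => deriv X u c) (Set.Icc 0 T) := by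
  refine Measure.integrableOn_of_bounded (M := M) (by simp)
    (measurable_deriv_coord X c).aestronglyMeasurable ?_
  filter_upwards [hX] with u hu using (PiLp.norm_apply_le (deriv X u) c).trans hu.2

/-- Each integration of `u ^ j` contributes a factor `1 / (j + 1)`. This decay yields every
convergence statement for the kernel. -/
theorem abs_signature_le (hM : 0 ≤ M) (hX : HasBoundedVelocity T M X) (j : ℕ) :
    ∀ (α : Fin j → Fin d) {s : ℝ}, s ∈ Set.Icc 0 T →
      |signature X s j α| ≤ (M * s) ^ j / j.factorial := by
  induction j with
  | zero => intro α s _; simp [signature]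
  | succ j ih =>
    intro α s hs
    rw [signature]
    have hle := intervalIntegral.norm_integral_le_of_norm_le (μ := volume)
      (f := fun u => signature X u j (Fin.init α) * (deriv X u) (α (Fin.last j)))
      (g := fun u => M ^ (j + 1) / j.factorial * u ^ j) hs.1 ?_
      (by apply Continuous.intervalIntegrable; fun_prop)
    · refine hle.trans (le_of_eq ?_)
      rw [intervalIntegral.integral_const_mul, integral_pow, Nat.factorial_succ]
      push_cast
      have : (j.factorial : ℝ) ≠ 0 := by positivity
      have : (j : ℝ) + 1 ≠ 0 := by positivity
      field_simp
      simp [mul_pow]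
    · filter_upwards [hX.ae_abs_le hs.2 (α (Fin.last j))] with u hu hus
      rw [norm_mul, Real.norm_eq_abs, Real.norm_eq_abs]
      refine (mul_le_mul (ih (Fin.init α) ⟨hus.1.le, hus.2.trans hs.2⟩) (hu hus)
        (abs_nonneg _) ?_).trans (le_of_eq ?_)
      · have := hus.1.le
        positivity
      · ring

theorem continuousOn_signature (hT : 0 ≤ T) (hX : HasBoundedVelocity T M X) (j : ℕ) :
    ∀ α : Fin j → Fin d, ContinuousOn (fun s => signature X s j α) (Set.Icc 0 T) := by
  induction j with
  | zero => intro α; simpa [signature] using continuousOn_const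
  | succ j ih =>
    intro α
    simp_rw [signature]
    rw [← Set.uIcc_of_le hT]
    apply intervalIntegral.continuousOn_primitive_interval
    rw [Set.uIcc_of_le hT]
    exact (hX.integrableOn_deriv_coord _).continuousOn_mul (ih (Fin.init α)) isCompact_Icc

theorem signature_succ_eq_setIntegral {s : ℝ} (hs : 0 ≤ s) (j : ℕ) (α : Fin (j + 1) → Fin d) :
    signature X s (j + 1) α =
      ∫ u in Set.Icc 0 s, signature X u j (Fin.init α) * (deriv X u) (α (Fin.last j)) := by
  rw [signature, intervalIntegral.integral_of_le hs, integral_Icc_eq_integral_Ioc]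

theorem summable_sum_signature_sq (hM : 0 ≤ M) (hX : HasBoundedVelocity T M X) {s : ℝ}
    (hs : s ∈ Set.Icc 0 T) :
    Summable fun j : ℕ => ∑ α : Fin j → Fin d, signature X s j α ^ 2 := by
  refine Summable.of_nonneg_of_le (fun j => Finset.sum_nonneg fun _ _ => sq_nonneg _) (fun j => ?_)
    (Real.summable_pow_div_factorial (d * (M * s) ^ 2))
  have h0 : 0 ≤ M * s := mul_nonneg hM hs.1
  have hj : (1 : ℝ) ≤ j.factorial := by exact_mod_cast j.factorial_pos
  calc ∑ α : Fin j → Fin d, signature X s j α ^ 2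
      ≤ ∑ _α : Fin j → Fin d, ((M * s) ^ 2) ^ j / j.factorial := by
        refine Finset.sum_le_sum fun α _ => ?_
        calc signature X s j α ^ 2 = |signature X s j α| ^ 2 := (sq_abs _).symm
          _ ≤ ((M * s) ^ j / j.factorial) ^ 2 :=
            pow_le_pow_left₀ (abs_nonneg _) (abs_signature_le hM hX j α hs) 2
          _ = ((M * s) ^ 2) ^ j / (j.factorial * j.factorial) := by ring
          -- One factorial suffices to beat the `d ^ j` words of length `j`, so the other is
          -- dropped.
          _ ≤ _ := div_le_div_of_nonneg_left (by positivity) (by positivity)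
            (le_mul_of_one_le_left (by positivity) hj)
    _ = (d * (M * s) ^ 2) ^ j / j.factorial := by
        simp [mul_pow]; ring

end Velocity

/-! ### Duality of forward and backward Volterra equations -/

section Adjoint

variable {α : Type*} [MeasurableSpace α] [Preorder α] [TopologicalSpace α]
  [OrderClosedTopology α] [SecondCountableTopology α] [OpensMeasurableSpace α]
  {μ : Measure α} [SFinite μ]

/-- Integration over `Set.Iic` and integration over `Set.Ici` are adjoint to each other. -/
theorem integral_mul_setIntegral_Iic {f g : α → ℝ} (hf : Integrable f μ) (hg : Integrable g μ) :
    ∫ p, g p * ∫ q in Set.Iic p, f q ∂μ ∂μ = ∫ q, f q * ∫ p in Set.Ici q, g p ∂μ ∂μ := by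
  have hS : MeasurableSet {z : α × α | z.2 ≤ z.1} :=
    (isClosed_le continuous_snd continuous_fst).measurableSet
  -- Both sides integrate `g p * f q` over `{q ≤ p}`; the indicator makes Fubini applicable.
  have hint : Integrable
      (Function.uncurry fun p q => g p * (Set.Iic p).indicator f q) (μ.prod μ) := by
    refine ((hg.mul_prod hf).indicator hS).congr (Filter.Eventually.of_forall fun z => ?_)
    by_cases h : z.2 ≤ z.1 <;> simp [Set.indicator, Function.uncurry, h]
  calc ∫ p, g p * ∫ q in Set.Iic p, f q ∂μ ∂μ
      = ∫ p, ∫ q, g p * (Set.Iic p).indicator f q ∂μ ∂μ := by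
        simp_rw [integral_const_mul, integral_indicator measurableSet_Iic]
    _ = ∫ q, ∫ p, g p * (Set.Iic p).indicator f q ∂μ ∂μ := integral_integral_swap hint
    _ = ∫ q, ∫ p, f q * (Set.Ici q).indicator g p ∂μ ∂μ := by
        congr! 4 with q p
        by_cases h : q ≤ p <;> simp [Set.indicator, h, mul_comm]
    _ = _ := by simp_rw [integral_const_mul, integral_indicator measurableSet_Ici]

/-- Pairing a solution `U` of the forward Volterra equation with weight `w'` and a solution `V` of
the backward Volterra equation with weight `w`. -/
theorem integral_forward_sub_backward {w w' U V : α → ℝ}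
    (hw'U : Integrable (fun p => w' p * U p) μ) (hwV : Integrable (fun p => w p * V p) μ)
    (hwUV : Integrable (fun p => w p * V p * U p) μ)
    (hw'UV : Integrable (fun p => w' p * U p * V p) μ)
    (hU : ∀ᵐ p ∂μ, U p = 1 + ∫ q in Set.Iic p, w' q * U q ∂μ)
    (hV : ∀ᵐ p ∂μ, V p = 1 + ∫ q in Set.Ici p, w q * V q ∂μ) :
    ∫ p, w' p * U p ∂μ = ∫ p, w p * V p ∂μ + ∫ p, (w' p - w p) * (U p * V p) ∂μ := by
  -- The two adjoint pairings are evaluated by replacing the inner integrals with `V p - 1` and `U p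
  -- - 1`.
  have h1 : ∫ p, w' p * U p * ∫ q in Set.Ici p, w q * V q ∂μ ∂μ
      = ∫ p, w' p * U p * V p ∂μ - ∫ p, w' p * U p ∂μ := by
    rw [← integral_sub hw'UV hw'U]
    refine integral_congr_ae ?_
    filter_upwards [hV] with p hp
    linear_combination (-(w' p * U p)) * hp
  have h2 : ∫ p, w p * V p * ∫ q in Set.Iic p, w' q * U q ∂μ ∂μ
      = ∫ p, w p * V p * U p ∂μ - ∫ p, w p * V p ∂μ := by
    rw [← integral_sub hwUV hwV]
    refine integral_congr_ae ?_
    filter_upwards [hU] with p hp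
    linear_combination (-(w p * V p)) * hp
  have h3 : ∫ p, (w' p - w p) * (U p * V p) ∂μ
      = ∫ p, w' p * U p * V p ∂μ - ∫ p, w p * V p * U p ∂μ := by
    rw [← integral_sub hw'UV hwUV]
    congr with p
    ring
  have h4 := integral_mul_setIntegral_Iic hw'U hwV
  linarith

end Adjoint

/-! ### The Goursat equations of the kernel -/

section Kernel

variable {d : ℕ} {a b M N : ℝ} {X Y : ℝ → EuclideanSpace ℝ (Fin d)}

/-- The contribution of the words of length `j` to the signature kernel. -/
noncomputable def kernelLevel {d : ℕ} (X Y : ℝ → EuclideanSpace ℝ (Fin d)) (j : ℕ)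
    (p : ℝ × ℝ) : ℝ :=
  ∑ α : Fin j → Fin d, signature X p.1 j α * signature Y p.2 j α

/-- The inner product of the velocities of two paths. -/
noncomputable def velocityInner {d : ℕ} (X Y : ℝ → EuclideanSpace ℝ (Fin d)) (p : ℝ × ℝ) : ℝ :=
  inner ℝ (deriv X p.1) (deriv Y p.2)

theorem measurable_velocityInner (X Y : ℝ → EuclideanSpace ℝ (Fin d)) :
    Measurable (velocityInner X Y) :=
  ((measurable_deriv X).comp measurable_fst).inner ((measurable_deriv Y).comp measurable_snd)

theorem volume_restrict_Icc_prod (p q : ℝ × ℝ) :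
    (volume : Measure (ℝ × ℝ)).restrict (Set.Icc p q) =
      (volume.restrict (Set.Icc p.1 q.1)).prod (volume.restrict (Set.Icc p.2 q.2)) := by
  rw [Measure.prod_restrict, ← Set.Icc_prod_eq, Measure.volume_eq_prod]

theorem ae_abs_velocityInner_le (hX : HasBoundedVelocity a M X) (hY : HasBoundedVelocity b N Y) :
    ∀ᵐ p ∂volume.restrict (Set.Icc (0 : ℝ × ℝ) (a, b)), |velocityInner X Y p| ≤ M * N := by
  rw [volume_restrict_Icc_prod]
  filter_upwards [Measure.quasiMeasurePreserving_fst.ae hX,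
    Measure.quasiMeasurePreserving_snd.ae hY] with p h1 h2
  exact (abs_real_inner_le_norm _ _).trans
    (mul_le_mul h1.2 h2.2 (norm_nonneg _) ((norm_nonneg _).trans h1.2))

theorem integrableOn_velocityInner (hX : HasBoundedVelocity a M X)
    (hY : HasBoundedVelocity b N Y) :
    IntegrableOn (velocityInner X Y) (Set.Icc (0 : ℝ × ℝ) (a, b)) :=
  Measure.integrableOn_of_bounded isCompact_Icc.measure_lt_top.ne
    (measurable_velocityInner X Y).aestronglyMeasurable (ae_abs_velocityInner_le hX hY)

theorem abs_kernelLevel_le (hM : 0 ≤ M) (hN : 0 ≤ N) (hX : HasBoundedVelocity a M X)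
    (hY : HasBoundedVelocity b N Y) (j : ℕ) {p : ℝ × ℝ} (hp : p ∈ Set.Icc 0 (a, b)) :
    |kernelLevel X Y j p| ≤ (d * ((M * a) * (N * b))) ^ j / j.factorial := by
  have hj : (1 : ℝ) ≤ j.factorial := by exact_mod_cast j.factorial_pos
  have h1 : 0 ≤ p.1 := hp.1.1
  have h2 : 0 ≤ p.2 := hp.1.2
  have h3 : p.1 ≤ a := hp.2.1
  have h4 : p.2 ≤ b := hp.2.2
  have hMa : 0 ≤ M * a := mul_nonneg hM (h1.trans h3)
  have hNb : 0 ≤ N * b := mul_nonneg hN (h2.trans h4)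
  calc |kernelLevel X Y j p|
      ≤ ∑ α : Fin j → Fin d, |signature X p.1 j α * signature Y p.2 j α| :=
        Finset.abs_sum_le_sum_abs _ _
    _ ≤ ∑ _α : Fin j → Fin d, ((M * a) * (N * b)) ^ j / j.factorial := by
        refine Finset.sum_le_sum fun α _ => ?_
        rw [abs_mul]
        calc |signature X p.1 j α| * |signature Y p.2 j α|
            ≤ ((M * p.1) ^ j / j.factorial) * ((N * p.2) ^ j / j.factorial) :=
              mul_le_mul (abs_signature_le hM hX j α ⟨h1, h3⟩)
                (abs_signature_le hN hY j α ⟨h2, h4⟩) (abs_nonneg _) (by positivity)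
          _ ≤ ((M * a) ^ j / j.factorial) * (N * b) ^ j := by
              refine mul_le_mul (by gcongr) ?_ (by positivity) (by positivity)
              exact (div_le_self (by positivity) hj).trans (by gcongr)
          _ = ((M * a) * (N * b)) ^ j / j.factorial := by ring
    _ = _ := by simp [mul_pow]; ring

theorem continuousOn_kernelLevel (ha : 0 ≤ a) (hb : 0 ≤ b) (hX : HasBoundedVelocity a M X)
    (hY : HasBoundedVelocity b N Y) (j : ℕ) :
    ContinuousOn (kernelLevel X Y j) (Set.Icc 0 (a, b)) := by
  refine continuousOn_finsetSum _ fun α _ => ContinuousOn.mul ?_ ?_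
  · exact (continuousOn_signature ha hX j α).comp continuousOn_fst fun p hp => ⟨hp.1.1, hp.2.1⟩
  · exact (continuousOn_signature hb hY j α).comp continuousOn_snd fun p hp => ⟨hp.1.2, hp.2.2⟩

theorem integrableOn_signature_mul_deriv (ha : 0 ≤ a) (hX : HasBoundedVelocity a M X) (j : ℕ)
    (α : Fin j → Fin d) (c : Fin d) :
    IntegrableOn (fun u => signature X u j α * deriv X u c) (Set.Icc 0 a) := by
  exact (hX.integrableOn_deriv_coord c).continuousOn_mul (continuousOn_signature ha hX j α)
    isCompact_Icc

/-- A word of length `j + 1` is a prefix and a last letter. The product of the two outermost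
integrals is an integral over a rectangle, and summing over the last letter produces the inner
product of the velocities. -/
theorem kernelLevel_succ (hX : HasBoundedVelocity a M X) (hY : HasBoundedVelocity b N Y) (j : ℕ)
    {p : ℝ × ℝ} (hp : p ∈ Set.Icc 0 (a, b)) :
    kernelLevel X Y (j + 1) p =
      ∫ q in Set.Icc 0 p, velocityInner X Y q * kernelLevel X Y j q := by
  obtain ⟨h1, h2⟩ := hp.1
  obtain ⟨h3, h4⟩ := hp.2
  have hterm : ∀ (c : Fin d) (α : Fin j → Fin d),
      IntegrableOn (fun q : ℝ × ℝ => (signature X q.1 j α * deriv X q.1 c) *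
        (signature Y q.2 j α * deriv Y q.2 c)) (Set.Icc 0 p) := by
    intro c α
    rw [IntegrableOn, volume_restrict_Icc_prod]
    exact (integrableOn_signature_mul_deriv h1 (hX.mono h3 le_rfl) j α c).mul_prod
      (integrableOn_signature_mul_deriv h2 (hY.mono h4 le_rfl) j α c)
  have hsum : ∀ q : ℝ × ℝ, velocityInner X Y q * kernelLevel X Y j q =
      ∑ z : Fin d × (Fin j → Fin d), (signature X q.1 j z.2 * deriv X q.1 z.1) *
        (signature Y q.2 j z.2 * deriv Y q.2 z.1) := by
    intro q
    rw [velocityInner, kernelLevel, PiLp.inner_apply, Finset.sum_mul_sum, Fintype.sum_prod_type]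
    refine Finset.sum_congr rfl fun c _ => Finset.sum_congr rfl fun α _ => ?_
    simp only [RCLike.inner_apply, conj_trivial]
    ring
  simp_rw [hsum]
  rw [integral_finsetSum Finset.univ fun (z : Fin d × (Fin j → Fin d)) _ => hterm z.1 z.2,
    kernelLevel]
  refine (Fintype.sum_equiv (Fin.snocEquiv fun _ => Fin d) _ _ fun z => ?_).symm
  have hinit : Fin.init (Fin.snocEquiv (fun _ => Fin d) z) = z.2 :=
    Fin.init_snoc (α := fun _ => Fin d) z.1 z.2
  have hlast : Fin.snocEquiv (fun _ => Fin d) z (Fin.last j) = z.1 :=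
    Fin.snoc_last (α := fun _ => Fin d) z.1 z.2
  rw [signature_succ_eq_setIntegral h1, signature_succ_eq_setIntegral h2,
    volume_restrict_Icc_prod, hinit, hlast, ← integral_prod_mul]
  rfl

theorem signatureKernel_eq_tsum (X Y : ℝ → EuclideanSpace ℝ (Fin d)) (s t : ℝ) :
    signatureKernel X s Y t = ∑' j, kernelLevel X Y j (s, t) := rfl

theorem abs_signatureKernel_le (hM : 0 ≤ M) (hN : 0 ≤ N) (hX : HasBoundedVelocity a M X)
    (hY : HasBoundedVelocity b N Y) {p : ℝ × ℝ} (hp : p ∈ Set.Icc 0 (a, b)) :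
    |signatureKernel X p.1 Y p.2| ≤ Real.exp (d * ((M * a) * (N * b))) := by
  rw [Real.exp_eq_exp_ℝ, NormedSpace.exp_eq_tsum_div]
  refine tsum_of_norm_bounded (f := fun j => kernelLevel X Y j p)
    (Real.summable_pow_div_factorial (d * ((M * a) * (N * b)))).hasSum fun j => ?_
  exact abs_kernelLevel_le hM hN hX hY j hp

theorem continuousOn_signatureKernel (ha : 0 ≤ a) (hb : 0 ≤ b) (hM : 0 ≤ M) (hN : 0 ≤ N)
    (hX : HasBoundedVelocity a M X) (hY : HasBoundedVelocity b N Y) :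
    ContinuousOn (fun p : ℝ × ℝ => signatureKernel X p.1 Y p.2) (Set.Icc 0 (a, b)) :=
  continuousOn_tsum (continuousOn_kernelLevel ha hb hX hY) (Real.summable_pow_div_factorial _)
    fun j _ hp => abs_kernelLevel_le hM hN hX hY j hp

/-- The signature kernel solves the Goursat problem in integrated form. -/
theorem signatureKernel_eq_one_add (hM : 0 ≤ M) (hN : 0 ≤ N) (hX : HasBoundedVelocity a M X)
    (hY : HasBoundedVelocity b N Y) {p : ℝ × ℝ} (hp : p ∈ Set.Icc 0 (a, b)) :
    signatureKernel X p.1 Y p.2 =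
      1 + ∫ q in Set.Icc 0 p, velocityInner X Y q * signatureKernel X q.1 Y q.2 := by
  have hX' := hX.mono hp.2.1 le_rfl
  have hY' := hY.mono hp.2.2 le_rfl
  have hw := integrableOn_velocityInner hX' hY'
  set r : ℝ := d * ((M * p.1) * (N * p.2))
  set B : ℕ → ℝ := fun j => r ^ j / j.factorial
  have hB : Summable B := Real.summable_pow_div_factorial r
  have hk : ∀ j, ∀ q ∈ Set.Icc 0 p, |kernelLevel X Y j q| ≤ B j :=
    fun j q hq => abs_kernelLevel_le hM hN hX' hY' j hq
  have hsum : ∀ q ∈ Set.Icc 0 p, Summable fun j => kernelLevel X Y j q :=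
    fun q hq => Summable.of_norm_bounded hB fun j => hk j q hq
  have hmeas : ∀ j, AEStronglyMeasurable (fun q => velocityInner X Y q * kernelLevel X Y j q)
      (volume.restrict (Set.Icc 0 p)) := fun j =>
    (measurable_velocityInner X Y).aestronglyMeasurable.mul
      ((continuousOn_kernelLevel hp.1.1 hp.1.2 hX' hY' j).aestronglyMeasurable measurableSet_Icc)
  have hle : ∀ j, ∀ᵐ q ∂volume.restrict (Set.Icc 0 p), ‖velocityInner X Y q * kernelLevel X Y j q‖
      ≤ M * N * B j := by
    intro j
    filter_upwards [ae_abs_velocityInner_le hX' hY', ae_restrict_mem measurableSet_Icc]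
      with q hq hqp
    rw [norm_mul]
    exact mul_le_mul hq (hk j q hqp) (abs_nonneg _) (mul_nonneg hM hN)
  have hlim : ∀ᵐ q ∂volume.restrict (Set.Icc 0 p),
      HasSum (fun j => velocityInner X Y q * kernelLevel X Y j q)
        (velocityInner X Y q * signatureKernel X q.1 Y q.2) := by
    filter_upwards [ae_restrict_mem measurableSet_Icc] with q hqp
    exact (hsum q hqp).hasSum.mul_left _
  -- The recursion between levels is summed under the integral, dominated by an exponential series.
  have key := hasSum_integral_of_dominated_convergence (fun j _ => M * N * B j) hmeas hle
    (Filter.Eventually.of_forall fun _ => hB.mul_left _)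
    (integrableOn_const isCompact_Icc.measure_lt_top.ne) hlim
  rw [← key.tsum_eq, signatureKernel_eq_tsum,
    (hsum p (Set.right_mem_Icc.2 hp.1)).tsum_eq_zero_add]
  congr 1
  · simp [kernelLevel, signature]
  · exact tsum_congr fun j => kernelLevel_succ hX hY j hp

theorem deriv_reversedPath (X : ℝ → EuclideanSpace ℝ (Fin d)) (a t : ℝ) :
    deriv (reversedPath a X) t = -deriv X (a - t) :=
  deriv_comp_const_sub X a t

/-- The two signs from reversing time cancel. -/
theorem velocityInner_reversedPath (X Y : ℝ → EuclideanSpace ℝ (Fin d)) (a b : ℝ) (p : ℝ × ℝ) :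
    velocityInner (reversedPath a X) (reversedPath b Y) p = velocityInner X Y ((a, b) - p) := by
  simp only [velocityInner, deriv_reversedPath, inner_neg_neg, Prod.fst_sub, Prod.snd_sub]

/-- The kernel of the reversed paths solves the backward Goursat problem in integrated form. -/
theorem signatureKernel_reversedPath_eq_one_add (hM : 0 ≤ M) (hN : 0 ≤ N)
    (hX : HasBoundedVelocity a M X) (hY : HasBoundedVelocity b N Y) {p : ℝ × ℝ}
    (hp : p ∈ Set.Icc 0 (a, b)) :
    signatureKernel (reversedPath a X) (a - p.1) (reversedPath b Y) (b - p.2) =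
      1 + ∫ q in Set.Icc p (a, b), velocityInner X Y q *
        signatureKernel (reversedPath a X) (a - q.1) (reversedPath b Y) (b - q.2) := by
  have hmem : (a, b) - p ∈ Set.Icc 0 (a, b) := ⟨sub_nonneg.2 hp.2, sub_le_self _ hp.1⟩
  have h := signatureKernel_eq_one_add hM hN hX.reversedPath hY.reversedPath hmem
  simp only [velocityInner_reversedPath] at h
  refine h.trans (congrArg _ ?_)
  -- The reflection `q ↦ (a, b) - q` carries `[p, (a, b)]` onto `[0, (a, b) - p]`.
  rw [← (Measure.measurePreserving_sub_left volume (a, b)).setIntegral_preimage_emb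
    (MeasurableEquiv.subLeft (a, b)).measurableEmbedding]
  simp [Set.preimage_const_sub_Icc]

end Kernel

/-! ### Perturbing the first path -/

section Perturbation

variable {d : ℕ} {a b M M' N L : ℝ} {X X' Y γ : ℝ → EuclideanSpace ℝ (Fin d)}

theorem continuousOn_signatureKernel_reversedPath (ha : 0 ≤ a) (hb : 0 ≤ b) (hM : 0 ≤ M)
    (hN : 0 ≤ N) (hX : HasBoundedVelocity a M X) (hY : HasBoundedVelocity b N Y) :
    ContinuousOn (fun p : ℝ × ℝ =>
      signatureKernel (reversedPath a X) (a - p.1) (reversedPath b Y) (b - p.2))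
      (Set.Icc 0 (a, b)) :=
  (continuousOn_signatureKernel ha hb hM hN hX.reversedPath hY.reversedPath).comp
    (f := fun p : ℝ × ℝ => (a, b) - p) (by fun_prop)
    fun _ hp => ⟨sub_nonneg.2 hp.2, sub_le_self _ hp.1⟩

theorem abs_signatureKernel_reversedPath_le (hM : 0 ≤ M) (hN : 0 ≤ N)
    (hX : HasBoundedVelocity a M X) (hY : HasBoundedVelocity b N Y) {p : ℝ × ℝ}
    (hp : p ∈ Set.Icc 0 (a, b)) :
    |signatureKernel (reversedPath a X) (a - p.1) (reversedPath b Y) (b - p.2)| ≤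
      Real.exp (d * ((M * a) * (N * b))) :=
  abs_signatureKernel_le hM hN hX.reversedPath hY.reversedPath (p := (a, b) - p)
    ⟨sub_nonneg.2 hp.2, sub_le_self _ hp.1⟩

theorem setIntegral_Iic_restrict_Icc {c p : ℝ × ℝ} (hp : p ≤ c) (f : ℝ × ℝ → ℝ) :
    ∫ q in Set.Iic p, f q ∂volume.restrict (Set.Icc 0 c) = ∫ q in Set.Icc 0 p, f q := by
  rw [Measure.restrict_restrict measurableSet_Iic]
  congr 2
  ext q
  exact ⟨fun h => ⟨h.2.1, h.1⟩, fun h => ⟨h.2, h.1, h.2.trans hp⟩⟩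

theorem setIntegral_Ici_restrict_Icc {c p : ℝ × ℝ} (hp : 0 ≤ p) (f : ℝ × ℝ → ℝ) :
    ∫ q in Set.Ici p, f q ∂volume.restrict (Set.Icc 0 c) = ∫ q in Set.Icc p c, f q := by
  rw [Measure.restrict_restrict measurableSet_Ici]
  congr 2
  ext q
  exact ⟨fun h => ⟨h.1, h.2.2⟩, fun h => ⟨h.1, hp.trans h.1, h.2⟩⟩

/-- Exact formula for the change of the signature kernel under a change of the first path. -/
theorem signatureKernel_sub (ha : 0 ≤ a) (hb : 0 ≤ b) (hM : 0 ≤ M) (hM' : 0 ≤ M') (hN : 0 ≤ N)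
    (hX : HasBoundedVelocity a M X) (hX' : HasBoundedVelocity a M' X')
    (hY : HasBoundedVelocity b N Y) :
    signatureKernel X' a Y b - signatureKernel X a Y b =
      ∫ p in Set.Icc 0 (a, b), (velocityInner X' Y p - velocityInner X Y p) *
        (signatureKernel X' p.1 Y p.2 *
          signatureKernel (reversedPath a X) (a - p.1) (reversedPath b Y) (b - p.2)) := by
  have hV := continuousOn_signatureKernel_reversedPath ha hb hM hN hX hY
  have hw := integrableOn_velocityInner hX hY
  have hwV := hw.mul_continuousOn hV isCompact_Icc
  have hVeq : ∀ᵐ p ∂volume.restrict (Set.Icc (0 : ℝ × ℝ) (a, b)),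
      signatureKernel (reversedPath a X) (a - p.1) (reversedPath b Y) (b - p.2) =
      1 + ∫ q in Set.Ici p, velocityInner X Y q *
        signatureKernel (reversedPath a X) (a - q.1) (reversedPath b Y) (b - q.2)
        ∂volume.restrict (Set.Icc 0 (a, b)) := by
    filter_upwards [ae_restrict_mem measurableSet_Icc] with p hp
    rw [setIntegral_Ici_restrict_Icc hp.1]
    exact signatureKernel_reversedPath_eq_one_add hM hN hX hY hp
  -- The backward solution stays that of `X` while `Z` varies. For `Z = X` the correction term
  -- vanishes, so subtracting the cases `X'` and `X` leaves the claim.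
  have main : ∀ {Z : ℝ → EuclideanSpace ℝ (Fin d)} {K : ℝ}, 0 ≤ K → HasBoundedVelocity a K Z →
      signatureKernel Z a Y b = 1 + ((∫ p in Set.Icc 0 (a, b), velocityInner X Y p *
          signatureKernel (reversedPath a X) (a - p.1) (reversedPath b Y) (b - p.2)) +
        ∫ p in Set.Icc 0 (a, b), (velocityInner Z Y p - velocityInner X Y p) *
          (signatureKernel Z p.1 Y p.2 *
            signatureKernel (reversedPath a X) (a - p.1) (reversedPath b Y) (b - p.2))) := by
    intro Z K hK hZ
    have hU := continuousOn_signatureKernel ha hb hK hN hZ hY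
    have hwU := (integrableOn_velocityInner hZ hY).mul_continuousOn hU isCompact_Icc
    have hUeq : ∀ᵐ p ∂volume.restrict (Set.Icc (0 : ℝ × ℝ) (a, b)), signatureKernel Z p.1 Y p.2 =
        1 + ∫ q in Set.Iic p, velocityInner Z Y q * signatureKernel Z q.1 Y q.2
          ∂volume.restrict (Set.Icc 0 (a, b)) := by
      filter_upwards [ae_restrict_mem measurableSet_Icc] with p hp
      rw [setIntegral_Iic_restrict_Icc hp.2]
      exact signatureKernel_eq_one_add hK hN hZ hY hp
    rw [← integral_forward_sub_backward hwU hwV (hwV.mul_continuousOn hU isCompact_Icc)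
      (hwU.mul_continuousOn hV isCompact_Icc) hUeq hVeq]
    exact signatureKernel_eq_one_add hK hN hZ hY (Set.right_mem_Icc.2 ⟨ha, hb⟩)
  rw [main hM' hX', main hM hX]
  simp

/-- The weight is linear in the velocity, so `ε` factors out; the forward kernel on the right is
still the perturbed one. -/
theorem signatureKernel_add_smul (ha : 0 ≤ a) (hb : 0 ≤ b) (hM : 0 ≤ M) (hL : 0 ≤ L) (hN : 0 ≤ N)
    (hX : HasBoundedVelocity a M X) (hγ : HasBoundedVelocity a L γ)
    (hY : HasBoundedVelocity b N Y) (ε : ℝ) :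
    signatureKernel (fun u => X u + ε • γ u) a Y b - signatureKernel X a Y b =
      ε * ∫ p in Set.Icc 0 (a, b), velocityInner γ Y p *
        (signatureKernel (fun u => X u + ε • γ u) p.1 Y p.2 *
          signatureKernel (reversedPath a X) (a - p.1) (reversedPath b Y) (b - p.2)) := by
  rw [signatureKernel_sub ha hb hM (by positivity) hN hX (hX.add_smul hγ ε) hY,
    ← integral_const_mul]
  refine integral_congr_ae ?_
  have hd : ∀ᵐ p ∂volume.restrict (Set.Icc (0 : ℝ × ℝ) (a, b)),
      deriv (fun u => X u + ε • γ u) p.1 = deriv X p.1 + ε • deriv γ p.1 := by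
    rw [volume_restrict_Icc_prod]
    exact Measure.quasiMeasurePreserving_fst.ae (hX.deriv_add_smul hγ ε)
  filter_upwards [hd] with p hp
  rw [velocityInner, hp, inner_add_left, real_inner_smul_left, velocityInner, velocityInner]
  ring

theorem ae_abs_perturbed_integrand_le (hM : 0 ≤ M) (hL : 0 ≤ L) (hN : 0 ≤ N)
    (hX : HasBoundedVelocity a M X) (hγ : HasBoundedVelocity a L γ)
    (hY : HasBoundedVelocity b N Y) {ε : ℝ} (hε : |ε| ≤ 1) :
    ∀ᵐ p ∂volume.restrict (Set.Icc (0 : ℝ × ℝ) (a, b)), ‖velocityInner γ Y p *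
        (signatureKernel (fun u => X u + ε • γ u) p.1 Y p.2 *
          signatureKernel (reversedPath a X) (a - p.1) (reversedPath b Y) (b - p.2))‖ ≤
      L * N * (Real.exp (d * (((M + L) * a) * (N * b))) * Real.exp (d * ((M * a) * (N * b)))) := by
  have hXε : HasBoundedVelocity a (M + L) fun u => X u + ε • γ u :=
    (hX.add_smul hγ ε).mono le_rfl (by gcongr; exact mul_le_of_le_one_left hL hε)
  filter_upwards [ae_abs_velocityInner_le hγ hY, ae_restrict_mem measurableSet_Icc] with p hp hpm
  rw [norm_mul, norm_mul]
  exact mul_le_mul hp (mul_le_mul (abs_signatureKernel_le (by positivity) hN hXε hY hpm)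
    (abs_signatureKernel_reversedPath_le hM hN hX hY hpm) (abs_nonneg _) (by positivity))
    (by positivity) (by positivity)

/-- The exact difference formula, with an integrand bounded uniformly for `|ε| ≤ 1`, gives a bound
`|ε| * C`. -/
theorem tendsto_signatureKernel_add_smul (ha : 0 ≤ a) (hb : 0 ≤ b) (hM : 0 ≤ M) (hL : 0 ≤ L)
    (hN : 0 ≤ N) (hX : HasBoundedVelocity a M X) (hγ : HasBoundedVelocity a L γ)
    (hY : HasBoundedVelocity b N Y) :
    Filter.Tendsto (fun ε : ℝ => signatureKernel (fun u => X u + ε • γ u) a Y b) (nhds 0)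
      (nhds (signatureKernel X a Y b)) := by
  obtain ⟨C, hC⟩ : ∃ C : ℝ, ∀ ε : ℝ, |ε| ≤ 1 →
      |signatureKernel (fun u => X u + ε • γ u) a Y b - signatureKernel X a Y b| ≤ |ε| * C := by
    refine ⟨L * N * (Real.exp (d * (((M + L) * a) * (N * b))) *
      Real.exp (d * ((M * a) * (N * b)))) * volume.real (Set.Icc (0 : ℝ × ℝ) (a, b)),
      fun ε hε => ?_⟩
    rw [signatureKernel_add_smul ha hb hM hL hN hX hγ hY, abs_mul]
    exact mul_le_mul_of_nonneg_left (norm_setIntegral_le_of_norm_le_const_ae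
      isCompact_Icc.measure_lt_top (ae_abs_perturbed_integrand_le hM hL hN hX hγ hY hε))
      (abs_nonneg _)
  rw [tendsto_iff_norm_sub_tendsto_zero]
  refine squeeze_zero' (g := fun ε : ℝ => |ε| * C)
    (Filter.Eventually.of_forall fun _ => norm_nonneg _) ?_ ?_
  · filter_upwards [Metric.closedBall_mem_nhds (0 : ℝ) one_pos] with ε hε
    exact hC ε (by simpa using hε)
  · have : Continuous fun ε : ℝ => |ε| * C := by fun_prop
    simpa using this.tendsto 0

/-- The directional derivative of the signature kernel, as an integral over the rectangle. -/
theorem hasDerivAt_signatureKernel_add_smul (ha : 0 ≤ a) (hb : 0 ≤ b) (hM : 0 ≤ M) (hL : 0 ≤ L)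
    (hN : 0 ≤ N) (hX : HasBoundedVelocity a M X) (hγ : HasBoundedVelocity a L γ)
    (hY : HasBoundedVelocity b N Y) :
    HasDerivAt (fun ε : ℝ => signatureKernel (fun u => X u + ε • γ u) a Y b)
      (∫ p in Set.Icc 0 (a, b), velocityInner γ Y p * (signatureKernel X p.1 Y p.2 *
        signatureKernel (reversedPath a X) (a - p.1) (reversedPath b Y) (b - p.2))) 0 := by
  rw [hasDerivAt_iff_tendsto_slope_zero]
  have hball : ∀ᶠ ε : ℝ in nhds 0, |ε| ≤ 1 := by
    filter_upwards [Metric.closedBall_mem_nhds (0 : ℝ) one_pos] with ε hε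
    simpa using hε
  have hlim := tendsto_integral_filter_of_dominated_convergence (l := nhds (0 : ℝ))
    (μ := volume.restrict (Set.Icc (0 : ℝ × ℝ) (a, b)))
    (F := fun ε p => velocityInner γ Y p *
      (signatureKernel (fun u => X u + ε • γ u) p.1 Y p.2 *
        signatureKernel (reversedPath a X) (a - p.1) (reversedPath b Y) (b - p.2)))
    (f := fun p => velocityInner γ Y p * (signatureKernel X p.1 Y p.2 *
        signatureKernel (reversedPath a X) (a - p.1) (reversedPath b Y) (b - p.2)))
    (fun _ => L * N *
      (Real.exp (d * (((M + L) * a) * (N * b))) * Real.exp (d * ((M * a) * (N * b)))))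
    (Filter.Eventually.of_forall fun ε => (measurable_velocityInner γ Y).aestronglyMeasurable.mul
      (((continuousOn_signatureKernel ha hb (by positivity) hN (hX.add_smul hγ ε) hY).mul
        (continuousOn_signatureKernel_reversedPath ha hb hM hN hX hY)).aestronglyMeasurable
          measurableSet_Icc))
    (hball.mono fun ε hε => ae_abs_perturbed_integrand_le hM hL hN hX hγ hY hε)
    (integrableOn_const isCompact_Icc.measure_lt_top.ne)
    (by
      filter_upwards [ae_restrict_mem measurableSet_Icc] with p hp
      -- Convergence at `p` is continuity in `ε` on the smaller rectangle `[0, p]`, which is why the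
      -- end times `a` and `b` are kept independent.
      exact ((tendsto_signatureKernel_add_smul hp.1.1 hp.1.2 hM hL hN (hX.mono hp.2.1 le_rfl)
        (hγ.mono hp.2.1 le_rfl) (hY.mono hp.2.2 le_rfl)).mul_const _).const_mul _)
  refine (hlim.mono_left nhdsWithin_le_nhds).congr' ?_
  filter_upwards [self_mem_nhdsWithin] with ε hε
  have h := signatureKernel_add_smul ha hb hM hL hN hX hγ hY ε
  simp only [zero_add, zero_smul, add_zero, smul_eq_mul]
  rw [h, inv_mul_cancel_left₀ hε]

end Perturbation

theorem theorem4p1 {d : ℕ} {T : ℝ} (hT : 0 < T)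
    (X Y γ : ℝ → EuclideanSpace ℝ (Fin d))
    (hX : IsPiecewiseLinear T X) (hY : IsPiecewiseLinear T Y) (hγ : IsPiecewiseLinear T γ) :
    -- signatures of (restricted) piecewise linear paths lie in the Hilbert space, so that all
    -- the kernels below are given by absolutely convergent series
    (∀ Z : ℝ → EuclideanSpace ℝ (Fin d), IsPiecewiseLinear T Z → ∀ s ∈ Set.Icc 0 T,
      Summable fun j : ℕ => ∑ α : Fin j → Fin d, signature Z s j α ^ 2) ∧
    -- the integrand is integrable on the square
    IntegrableOn
      (fun p : ℝ × ℝ => signatureKernel X p.1 Y p.2 *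
        signatureKernel (reversedPath T X) (T - p.1) (reversedPath T Y) (T - p.2) *
        inner ℝ (deriv γ p.1) (deriv Y p.2))
      (Set.Icc 0 T ×ˢ Set.Icc 0 T) ∧
    -- the directional derivative exists and is given by the formula
    HasDerivAt (fun ε : ℝ => signatureKernel (fun u => X u + ε • γ u) T Y T)
      (∫ t in (0 : ℝ)..T, ∫ s in (0 : ℝ)..T, signatureKernel X s Y t *
        signatureKernel (reversedPath T X) (T - s) (reversedPath T Y) (T - t) *
        inner ℝ (deriv γ s) (deriv Y t))
      0 := by
  obtain ⟨M, hM, hXM⟩ := hX.exists_hasBoundedVelocity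
  obtain ⟨N, hN, hYN⟩ := hY.exists_hasBoundedVelocity
  obtain ⟨L, hL, hγL⟩ := hγ.exists_hasBoundedVelocity
  have hint : IntegrableOn
      (fun p : ℝ × ℝ => signatureKernel X p.1 Y p.2 *
        signatureKernel (reversedPath T X) (T - p.1) (reversedPath T Y) (T - p.2) *
        inner ℝ (deriv γ p.1) (deriv Y p.2))
      (Set.Icc 0 T ×ˢ Set.Icc 0 T) := by
    rw [← Set.Icc_prod_eq (0, 0) (T, T)]
    exact (integrableOn_velocityInner hγL hYN).continuousOn_mul
      ((continuousOn_signatureKernel hT.le hT.le hM hN hXM hYN).mul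
        (continuousOn_signatureKernel_reversedPath hT.le hT.le hM hN hXM hYN)) isCompact_Icc
  refine ⟨fun Z hZ s hs => ?_, hint, ?_⟩
  · obtain ⟨K, hK, hZK⟩ := hZ.exists_hasBoundedVelocity
    exact summable_sum_signature_sq hK hZK hs
  · convert hasDerivAt_signatureKernel_add_smul hT.le hT.le hM hL hN hXM hγL hYN using 1
    rw [IntegrableOn, Measure.volume_eq_prod, ← Measure.prod_restrict] at hint
    simp_rw [intervalIntegral.integral_of_le hT.le, ← integral_Icc_eq_integral_Ioc]
    -- The inner variable is `s`, the first coordinate, hence the symmetric form of Fubini.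
    rw [← integral_prod_symm _ hint, volume_restrict_Icc_prod]
    refine integral_congr_ae (Filter.Eventually.of_forall fun p => ?_)
    exact mul_comm _ _
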